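/- Let $F_d$ be the free group on $a_1,\dots,a_d$ ($d\ge 0$), acting by left multiplication on its Cayley tree, with word length $|\cdot|$. For a subgroup $\Gamma\le F_d$ let $$\delta(\Gamma)=\inf\Big\{s>0 \;\Big|\; \sum_{\gamma\in\Gamma}e^{-s\,d(1,\gamma)}<\infty\Big\}$$ be its critical exponent, where $d(1,\gamma)=|\gamma|$ is the distance in the Cayley tree. Equip the set $\mathrm{Sub}(F_d)$ of subgroups with the Chabauty topology, i.e. the subspace topology from $\mathrm{Sub}(F_d)\subset\{0,1\}^{F_d}$. A subgroup $\Delta\le F_d$ is called a boomerang subgroup if for every $g\in F_d$ there is a sequence of natural numbers $n_k\to\infty$ with $\lim_{k\to\infty}g^{n_k}\Delta g^{-n_k}=\Delta$. **Theorem.** Let $\Gamma\le F_d$ be a finitely generated subgroup, $O\subset\mathrm{Sub}(F_d)$ a neighbourhood of $\Gamma$, and $\epsilon>0$. Then there is a boomerang subgroup $\Delta\in O$ of $F_d$ with $$\delta(\Gamma)\le\delta(\Delta)\le\delta(\Gamma)+\epsilon .$$ Moreover, $\Delta$ can be chosen as an increasing union $\Delta=\bigcup_{n\ge0}\Gamma_n$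 with $\Gamma_0=\Gamma$ for which there are an enumeration $F_d=\{g_1,g_2,\dots\}$ (possibly with repetitions) and natural numbers $m_1,m_2,\dots$ such that, for every $n\ge1$: if some positive power of $g_n$ lies in $\Gamma_{n-1}$, then $\Gamma_n=\Gamma_{n-1}$; otherwise $m_n\ge1$ and $\Gamma_n=\langle\Gamma_{n-1},\,g_n^{m_n}\Gamma_{n-1}g_n^{-m_n}\rangle$ is the internal free product $\Gamma_{n-1} * g_n^{m_n}\Gamma_{n-1}g_n^{-m_n}$. -/

import Mathlib

open scoped Pointwise Topology Monoid.Coprod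

noncomputable section

/-- The Chabauty topology on the set of subgroups of a (discrete) group `G`: the topology induced
by the embedding `Sub(G) ⊆ {0,1}^G` sending a subgroup to its indicator function, where `{0,1}`
is discrete and `{0,1}^G` carries the product topology. -/
instance Subgroup.chabautyTopology (G : Type*) [Group G] : TopologicalSpace (Subgroup G) :=
  open Classical in
  TopologicalSpace.induced (fun (H : Subgroup G) (g : G) => (decide (g ∈ H) : Bool))
    Pi.topologicalSpace

/-- A subgroup `Δ` is a boomerang subgroup if for every `g` there is a sequence `n k → ∞` such that
`g ^ (n k) * Δ * g ^ (-(n k))` converges to `Δ` in the Chabauty topology. -/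
def IsBoomerang {G : Type*} [Group G] (Δ : Subgroup G) : Prop :=
  ∀ g : G, ∃ n : ℕ → ℕ, Filter.Tendsto n Filter.atTop Filter.atTop ∧
    Filter.Tendsto (fun k => MulAut.conj (g ^ n k) • Δ) Filter.atTop (𝓝 Δ)

/-- The Cayley tree of the free group `F_d` with respect to its standard basis, with vertex set
`F_d` and edges joining `x` and `x * a_i`. The group acts on it by left multiplication. -/
def cayleyTree (d : ℕ) : SimpleGraph (FreeGroup (Fin d)) :=
  SimpleGraph.mulCayley (Set.range FreeGroup.of)

/-- The critical exponent of a subgroup `Γ` of a group `G` acting on the vertices of a graph `T`,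
with base vertex `x`: the infimum of all `s > 0` such that the Poincaré series
`∑ γ ∈ Γ, exp (-s * d(x, γ x))` converges. -/
def criticalExponentAt {G V : Type*} [Group G] [MulAction G V] (T : SimpleGraph V) (x : V)
    (Γ : Subgroup G) : ℝ :=
  sInf {s : ℝ | 0 < s ∧
    Summable fun γ : Γ => Real.exp (-s * (T.dist x ((γ : G) • x) : ℝ))}

/-- The critical exponent of a subgroup of `F_d` acting on its Cayley tree. The action is by
isometries, so the choice of the base point does not matter; we take the identity vertex. -/
def criticalExponent {d : ℕ} (Γ : Subgroup (FreeGroup (Fin d))) : ℝ :=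
  criticalExponentAt (cayleyTree d) 1 Γ

/-- `P` is the internal free product of its subgroups `A` and `B`: they generate `P`, and the
canonical homomorphism from the abstract free product `A ∗ B` is injective. -/
def IsInternalFreeProduct {G : Type*} [Group G] (A B P : Subgroup G) : Prop :=
  A ⊔ B = P ∧ Function.Injective (Monoid.Coprod.lift A.subtype B.subtype : A ∗ B →* G)

/-- `Γ' = Γ` if some positive power of `g` lies in `Γ`; otherwise `Γ'` is the internal free product
of `Γ` and `g ^ m * Γ * g ^ (-m)`. -/
def IsFreeProductStep {G : Type*} [Group G] (g : G) (m : ℕ) (Γ Γ' : Subgroup G) : Prop :=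
  ((∃ k : ℕ, 1 ≤ k ∧ g ^ k ∈ Γ) → Γ' = Γ) ∧
  ((¬ ∃ k : ℕ, 1 ≤ k ∧ g ^ k ∈ Γ) →
    1 ≤ m ∧ IsInternalFreeProduct Γ (MulAut.conj (g ^ m) • Γ) Γ')

end

/-!
The subgroup `Δ` is the union of a chain `H 0 = Γ ≤ H 1 ≤ ⋯`, where `H (n + 1)` is generated by `H n`
and `t (H n) t⁻¹` for a very large power `t` of an element `g`, whenever no positive power of `g` lies
in `H n`. Each `g` is used infinitely often.

The geometric input is that the Cayley tree is `0`-hyperbolic (`FreeGroup.gromov_ultrametric`). A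
finitely generated subgroup `Γ` is quasiconvex, so if no positive power of `g` lies in `Γ`, the
pigeonhole principle bounds the time for which elements of `Γ` fellow-travel the rays of `g`
(`FreeGroup.exists_gromov_pow_le`). Moreover conjugating a nontrivial element of `Γ` by `t` adds
`2|t|` to its length, up to a constant (`FreeGroup.exists_le_norm_conj`). A local-to-global argument
in the tree then shows that a normal form `γ₀ t β₁ t⁻¹ α₁ ⋯ t βₙ t⁻¹ αₙ` is at least as long as all its
letters `γ₀, βᵢ, αᵢ` together, plus `n E`, where `E` is as large as desired if `t` is long enough
(`FreeGroup.IsTransverse.le_norm_mul_conjWord`). This has three consequences.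

* The normal form is nontrivial if `n ≥ 1`, so `⟨Γ, t Γ t⁻¹⟩` is a free product.
* A given finite set disjoint from `Γ` stays disjoint from `⟨Γ, t Γ t⁻¹⟩`, and so does its conjugate
  by `t`, because the elements with `n ≥ 1` are long.
* If `P < ∞` is the Poincaré series of `Γ` at `s`, that of `⟨Γ, t Γ t⁻¹⟩` is at most
  `P / (1 - P² e ^ (-s E))`, which is arbitrarily close to `P`.

Hence, with `s` between `δ(Γ)` and `δ(Γ) + ε`, all Poincaré series at `s` along the chain stay below a
fixed finite bound, which passes to `Δ` and gives `δ(Δ) ≤ s`. Excluding finite sets of elements forever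
keeps `Δ` in the given neighbourhood. Finally `Δ` contains `t (H n) t⁻¹`, and excluding `t x t⁻¹`
together with `x` for the first `n` elements `x` of the group that are not in `H n` makes `t⁻¹ Δ t`
agree with `Δ` on larger and larger finite sets.
-/

open scoped ENNReal

/-! ### Tree geometry of the word length -/

namespace FreeGroup

variable {α : Type*} [DecidableEq α]

/-- The length of the longest common prefix of two words. -/
def commonPrefixLength : List (α × Bool) → List (α × Bool) → ℕ
  | a :: l, b :: l' => if a = b then commonPrefixLength l l' + 1 else 0
  | _, _ => 0

theorem commonPrefixLength_ultrametric (u v w : List (α × Bool)) :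
    commonPrefixLength u v ≤ commonPrefixLength u w ∨
      commonPrefixLength v w ≤ commonPrefixLength u w := by
  induction u generalizing v w with
  | nil => left; simp [commonPrefixLength]
  | cons a u ih =>
    rcases v with _ | ⟨b, v⟩
    · left; simp [commonPrefixLength]
    rcases w with _ | ⟨c, w⟩
    · right; simp [commonPrefixLength]
    have := ih v w
    simp only [commonPrefixLength]
    split_ifs <;> grind

/-- Cancellation in `L₁⁻¹ L₂` removes exactly the common prefix of the reduced words. -/
theorem norm_inv_mk_mul_mk {L₁ L₂ : List (α × Bool)} (h₁ : IsReduced L₁) (h₂ : IsReduced L₂) :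
    ((mk L₁)⁻¹ * mk L₂).norm + 2 * commonPrefixLength L₁ L₂ = L₁.length + L₂.length := by
  have key : ∀ {L : List (α × Bool)}, IsReduced L → (mk L).norm = L.length := fun h => by
    rw [norm, toWord_mk, h.reduce_eq]
  induction L₁ generalizing L₂ with
  | nil =>
    rw [show (mk ([] : List (α × Bool)))⁻¹ = 1 by rw [← one_eq_mk, inv_one], one_mul, key h₂]
    simp [commonPrefixLength]
  | cons a u ih =>
    rcases L₂ with _ | ⟨b, v⟩
    · rw [← one_eq_mk, mul_one, norm_inv_eq, key h₁]
      simp [commonPrefixLength]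
    by_cases hab : a = b
    · subst hab
      have e : (mk (a :: u))⁻¹ * mk (a :: v) = (mk u)⁻¹ * mk v := by
        rw [← List.singleton_append, ← List.singleton_append (l := v), ← mul_mk, ← mul_mk]
        group
      have := ih (L₂ := v) (h₁.infix ⟨[a], [], by simp⟩) (h₂.infix ⟨[a], [], by simp⟩)
      rw [e]
      simp only [commonPrefixLength, if_true, List.length_cons]
      omega
    · have hr : IsReduced (invRev (a :: u) ++ b :: v) := by
        have h₁' : IsReduced (invRev (a :: u)) := by
          rw [isReduced_iff_reduce_eq, reduce_invRev, h₁.reduce_eq]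
        rw [IsReduced, List.isChain_append]
        refine ⟨h₁', h₂, ?_⟩
        rintro x hx y hy
        have hx' : x = (a.1, !a.2) := by simpa [invRev, eq_comm] using hx
        have hy' : y = b := by simpa [eq_comm] using hy
        subst hx' hy'
        intro h
        by_contra h'
        apply hab
        ext
        · exact h
        · revert h'
          cases a.2 <;> cases y.2 <;> simp
      rw [inv_mk, mul_mk, key hr]
      simp [commonPrefixLength, hab]

/-- Twice the Gromov product of `x` and `y` based at the identity vertex of the Cayley tree. It is
kept integer valued and doubled, so that bounds on it are bounds on differences of norms. -/
def gromov (x y : FreeGroup α) : ℤ := x.norm + y.norm - (x⁻¹ * y).norm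

theorem gromov_eq_commonPrefixLength (x y : FreeGroup α) :
    gromov x y = 2 * commonPrefixLength x.toWord y.toWord := by
  have := norm_inv_mk_mul_mk (isReduced_toWord (x := x)) (isReduced_toWord (x := y))
  rw [mk_toWord, mk_toWord] at this
  simp only [gromov, norm] at this ⊢
  omega

/-- The word metric is `0`-hyperbolic. -/
theorem gromov_ultrametric (x y z : FreeGroup α) :
    gromov x y ≤ gromov x z ∨ gromov y z ≤ gromov x z := by
  simp only [gromov_eq_commonPrefixLength]
  have := commonPrefixLength_ultrametric x.toWord y.toWord z.toWord
  omega

theorem gromov_comm (x y : FreeGroup α) : gromov x y = gromov y x := by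
  have : (x⁻¹ * y).norm = (y⁻¹ * x).norm := by rw [← norm_inv_eq]; simp
  simp only [gromov, this]; omega

theorem gromov_le_two_mul_norm_left (x y : FreeGroup α) : gromov x y ≤ 2 * x.norm := by
  have := norm_mul_le x (x⁻¹ * y)
  rw [mul_inv_cancel_left] at this
  simp only [gromov]; omega

theorem gromov_le_two_mul_norm_right (x y : FreeGroup α) : gromov x y ≤ 2 * y.norm := by
  rw [gromov_comm]; exact gromov_le_two_mul_norm_left y x

theorem norm_mul_eq_sub_gromov (x y : FreeGroup α) :
    ((x * y).norm : ℤ) = x.norm + y.norm - gromov x⁻¹ y := by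
  simp [gromov]

theorem gromov_mul_right (x y : FreeGroup α) :
    gromov x (x * y) = x.norm + (x * y).norm - y.norm := by
  simp [gromov]

theorem norm_pow_le (x : FreeGroup α) (n : ℕ) : (x ^ n).norm ≤ n * x.norm := by
  induction n with
  | zero => simp
  | succ n ih =>
    have := norm_mul_le (x ^ n) x
    rw [pow_succ, add_mul, one_mul]; omega

theorem finite_norm_le [Finite α] (R : ℤ) : {x : FreeGroup α | (x.norm : ℤ) ≤ R}.Finite := by
  refine ((List.finite_length_le (α × Bool) R.toNat).preimage
    toWord_injective.injOn).subset fun x hx => ?_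
  simp only [Set.mem_ofPred_eq, norm, Set.mem_preimage] at hx ⊢
  omega

/-- The translation length of a conjugate `y` of `δ` is at most `|δ|`. This is the four-point condition
for `1`, `y⁻¹`, `y` and the vertex `a`, which `y` moves by `|δ|`. -/
theorem norm_conj_sq_le (a δ : FreeGroup α) :
    ((a * δ * a⁻¹) ^ 2).norm ≤ (a * δ * a⁻¹).norm + δ.norm := by
  set y := a * δ * a⁻¹ with hy
  have h1 : ((y⁻¹)⁻¹ * a).norm ≤ a.norm + δ.norm := by
    rw [show (y⁻¹)⁻¹ * a = a * δ by simp [hy]]; exact norm_mul_le _ _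
  have h2 : (a⁻¹ * y).norm ≤ a.norm + δ.norm := by
    rw [show a⁻¹ * y = δ * a⁻¹ by simp [hy, mul_assoc]]
    have := norm_mul_le δ a⁻¹
    rw [norm_inv_eq] at this; omega
  have h3 : ((y⁻¹)⁻¹ * y).norm = (y ^ 2).norm := by rw [inv_inv, sq]
  have h4 : y⁻¹.norm = y.norm := norm_inv_eq
  have := gromov_ultrametric y⁻¹ a y
  simp only [gromov] at this
  omega

theorem norm_conj_pow_two_pow_le (a δ : FreeGroup α) (k : ℕ) :
    ((a * δ ^ 2 ^ k * a⁻¹).norm : ℤ) ≤ (a * δ * a⁻¹).norm + 2 ^ k * δ.norm := by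
  induction k with
  | zero => simp
  | succ k ih =>
    have h1 := norm_conj_sq_le a (δ ^ 2 ^ k)
    rw [conj_pow, ← pow_mul, ← pow_succ] at h1
    have h2 := norm_pow_le δ (2 ^ k)
    zify at h1 h2
    rw [pow_succ (2 : ℤ)]
    linarith

/-- A nontrivial element has arbitrarily long powers with exponent a power of two. -/
theorem exists_lt_norm_pow_two_pow [Finite α] {x : FreeGroup α} (hx : x ≠ 1) (R : ℤ) :
    ∃ k : ℕ, R < (x ^ 2 ^ k).norm := by
  by_contra! h
  have hfin := finite_norm_le (α := α) R
  obtain ⟨i, j, hij, he⟩ := hfin.exists_lt_map_eq_of_forall_mem (f := fun k : ℕ => x ^ 2 ^ k) h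
  have := injective_pow_iff_not_isOfFinOrder.2 (not_isOfFinOrder_of_isMulTorsionFree hx) he
  exact hij.ne (Nat.pow_right_injective le_rfl this)

/-! ### Powers of an element -/

/-- If `|h| < |h²|` then `h` is translated along its axis by `|h²| - |h|`, so that the norms of the
powers grow along an exact arithmetic progression. -/
theorem norm_pow_succ_of_norm_lt {h : FreeGroup α} (hh : h.norm < (h ^ 2).norm) (n : ℕ) :
    ((h ^ (n + 1)).norm : ℤ) = h.norm + n * ((h ^ 2).norm - h.norm) := by
  suffices H : ((h ^ (n + 1)).norm : ℤ) = h.norm + n * ((h ^ 2).norm - h.norm) ∧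
      ((h ^ (n + 2)).norm : ℤ) = (h ^ (n + 1)).norm + ((h ^ 2).norm - h.norm) from H.1
  induction n with
  | zero => simp
  | succ n ih =>
    obtain ⟨h1, h2⟩ := ih
    refine ⟨?_, ?_⟩
    · rw [show n + 1 + 1 = n + 2 by ring, h2, h1]; push_cast; ring
    · -- `h⁻¹` and `h` branch off before `h` and `h ^ (n + 2)` do.
      have e : gromov h⁻¹ h = 2 * h.norm - (h ^ 2).norm := by
        simp only [gromov, inv_inv, norm_inv_eq, sq]; ring
      have e1 := gromov_mul_right h (h ^ (n + 1))
      rw [← pow_succ'] at e1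
      have e2 := norm_mul_eq_sub_gromov h (h ^ (n + 2))
      rw [← pow_succ'] at e2
      have u1 := gromov_ultrametric h⁻¹ (h ^ (n + 2)) h
      have u2 := gromov_ultrametric h⁻¹ h (h ^ (n + 2))
      have := gromov_comm h (h ^ (n + 2))
      -- Restatements that make the exponents syntactically equal for `omega`.
      have e1' : gromov h (h ^ (n + 1 + 1)) = gromov h (h ^ (n + 2)) := rfl
      have e2' : (h ^ (n + 2 + 1)).norm = (h ^ (n + 1 + 2)).norm := rfl
      have e3' : (h ^ (n + 1 + 1)).norm = (h ^ (n + 2)).norm := rfl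
      omega

theorem le_norm_pow_of_norm_lt {h : FreeGroup α} (hh : h.norm < (h ^ 2).norm) (n : ℕ) :
    n ≤ (h ^ n).norm := by
  rcases n with _ | n
  · simp
  have h1 := norm_pow_succ_of_norm_lt hh n
  have h2 : 0 < h.norm := by
    rcases Nat.eq_zero_or_pos h.norm with h0 | h0
    · rw [norm_eq_zero] at h0; simp [h0] at hh
    · exact h0
  zify at h2 hh ⊢
  nlinarith

/-- Norms of powers are superadditive up to a constant. -/
theorem norm_pow_add_norm_pow_le {h : FreeGroup α} (hh : h.norm < (h ^ 2).norm) (i j : ℕ) :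
    ((h ^ i).norm : ℤ) + (h ^ j).norm ≤ (h ^ (i + j)).norm + 2 * h.norm := by
  rcases i with _ | i
  · simp
  rcases j with _ | j
  · simp
  have h1 := norm_pow_succ_of_norm_lt hh i
  have h2 := norm_pow_succ_of_norm_lt hh j
  have h3 := norm_pow_succ_of_norm_lt hh (i + 1 + j)
  rw [← add_assoc (i + 1), h1, h2, h3]
  push_cast
  zify at hh
  linarith

theorem exists_norm_pow_two_pow_lt [Finite α] {x : FreeGroup α} (hx : x ≠ 1) :
    ∃ k : ℕ, (x ^ 2 ^ k).norm < ((x ^ 2 ^ k) ^ 2).norm := by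
  by_contra! h
  have H : ∀ k : ℕ, (x ^ 2 ^ k).norm ≤ x.norm := fun k => by
    induction k with
    | zero => simp
    | succ k ih => rw [pow_succ, pow_mul]; exact (h k).trans ih
  obtain ⟨k, hk⟩ := exists_lt_norm_pow_two_pow hx x.norm
  have := H k
  omega

/-! ### Finitely generated subgroups are quasiconvex -/

/-- A vertex near a geodesic from `1` to an element of a finitely generated subgroup `Γ` is near
`Γ`. -/
theorem exists_mem_norm_inv_mul_le {Γ : Subgroup (FreeGroup α)} (hΓ : Γ.FG) {D : ℤ} (hD : 0 ≤ D) :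
    ∃ R : ℤ, ∀ γ ∈ Γ, ∀ x, 2 * (x.norm : ℤ) - D ≤ gromov γ x →
      ∃ γ' ∈ Γ, ((γ'⁻¹ * x).norm : ℤ) ≤ R := by
  obtain ⟨S, rfl⟩ := hΓ
  obtain ⟨R, hR⟩ := (S.image norm).bddAbove
  refine ⟨R + D, fun γ hγ => ?_⟩
  -- Along a product of generators, some partial product is near each vertex of the geodesic.
  have step : ∀ γ ∈ Subgroup.closure (S : Set (FreeGroup α)), ∀ t : FreeGroup α, t.norm ≤ R →
      (∀ x, 2 * (x.norm : ℤ) - D ≤ gromov γ x →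
        ∃ γ' ∈ Subgroup.closure (S : Set (FreeGroup α)), ((γ'⁻¹ * x).norm : ℤ) ≤ R + D) →
      ∀ x, 2 * (x.norm : ℤ) - D ≤ gromov (γ * t) x →
        ∃ γ' ∈ Subgroup.closure (S : Set (FreeGroup α)), ((γ'⁻¹ * x).norm : ℤ) ≤ R + D := by
    intro γ hγ t ht ih x hx
    by_cases hc : 2 * (x.norm : ℤ) - D ≤ gromov γ x
    · exact ih x hc
    refine ⟨γ, hγ, ?_⟩
    have h1 := gromov_ultrametric γ (γ * t) x
    have h2 := gromov_le_two_mul_norm_left (γ * t) x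
    have h3 := gromov_mul_right γ t
    simp only [gromov] at *
    omega
  induction hγ using Subgroup.closure_induction_right with
  | one =>
    intro x hx
    refine ⟨1, one_mem _, ?_⟩
    simp only [gromov, norm_one, inv_one, one_mul] at hx ⊢
    omega
  | mul_right γ hγ t ht ih =>
    exact step γ hγ t (hR (by simpa using ⟨t, ht, rfl⟩)) ih
  | mul_inv_cancel γ hγ t ht ih =>
    exact step γ hγ t⁻¹ (by rw [norm_inv_eq]; exact hR (by simpa using ⟨t, ht, rfl⟩)) ih

/-- If no positive power of `h` lies in `Γ`, the elements of `Γ` fellow-travel the positive ray of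
`h` for a bounded time only: otherwise all vertices `h ^ j` would be near `Γ`, and by the pigeonhole
principle two of them would lie in the same coset of `Γ`. -/
theorem exists_gromov_pow_le [Finite α] {Γ : Subgroup (FreeGroup α)} (hΓ : Γ.FG)
    {h : FreeGroup α} (hh : h.norm < (h ^ 2).norm) (hpow : ∀ k : ℕ, 1 ≤ k → h ^ k ∉ Γ) :
    ∃ C : ℤ, ∀ γ ∈ Γ, ∀ m : ℕ, gromov γ (h ^ m) ≤ C := by
  by_contra! H
  obtain ⟨R, hR⟩ := exists_mem_norm_inv_mul_le hΓ (D := 2 * h.norm) (by positivity)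
  have near : ∀ j : ℕ, ∃ γ' ∈ Γ, ((γ'⁻¹ * h ^ j).norm : ℤ) ≤ R := fun j => by
    obtain ⟨γ, hγ, m, hm⟩ := H (2 * (j * h.norm))
    have hjm : j ≤ m := by
      by_contra! hlt
      have h1 := gromov_le_two_mul_norm_right γ (h ^ m)
      have h2 := norm_pow_le h m
      have h3 : m * h.norm ≤ j * h.norm := Nat.mul_le_mul_right _ hlt.le
      zify at h2 h3
      linarith
    apply hR γ hγ
    obtain ⟨i, rfl⟩ := Nat.exists_eq_add_of_le hjm
    have h1 := norm_pow_add_norm_pow_le hh j i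
    have h2 := gromov_mul_right (h ^ j) (h ^ i)
    rw [← pow_add] at h2
    have h3 := gromov_comm (h ^ j) (h ^ (j + i))
    have h4 := norm_pow_le h j
    zify at h4
    have h5 := gromov_ultrametric γ (h ^ (j + i)) (h ^ j)
    omega
  choose f hf hfR using near
  obtain ⟨i, j, hij, he⟩ := (finite_norm_le (α := α) R).exists_lt_map_eq_of_forall_mem
    (f := fun j => (f j)⁻¹ * h ^ j) hfR
  apply hpow (j - i) (by omega)
  have : h ^ (j - i) = f j * (f i)⁻¹ := by
    rw [pow_sub _ hij.le]
    have he' : h ^ j = f j * ((f i)⁻¹ * h ^ i) := by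
      have he'' : (f i)⁻¹ * h ^ i = (f j)⁻¹ * h ^ j := he
      rw [he'', mul_inv_cancel_left]
    rw [he']; group
  rw [this]
  exact mul_mem (hf j) (inv_mem (hf i))

/-! ### Conjugates of nontrivial elements are long -/

theorem le_norm_conj_of_lt_norm {t δ : FreeGroup α} {C : ℤ} (h1 : gromov δ t⁻¹ ≤ C)
    (h2 : gromov δ⁻¹ t⁻¹ ≤ C) (hδ : C < δ.norm) :
    2 * (t.norm : ℤ) + δ.norm - 2 * C ≤ (t * δ * t⁻¹).norm := by
  have e1 := norm_mul_eq_sub_gromov δ t⁻¹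
  have e2 := gromov_mul_right δ t⁻¹
  have e3 := norm_mul_eq_sub_gromov t (δ * t⁻¹)
  have u := gromov_ultrametric δ (δ * t⁻¹) t⁻¹
  have c := gromov_comm t⁻¹ (δ * t⁻¹)
  have n : t⁻¹.norm = t.norm := norm_inv_eq
  rw [mul_assoc]
  omega

/-- Conjugating a nontrivial element of `Γ` by `t` adds `2|t|` to its length, up to a constant that
depends only on `Γ` and on the time for which `Γ` fellow-travels `t⁻¹`. A short element `δ` is
replaced by a long power of it, whose conjugate is not much longer than that of `δ`. -/
theorem exists_le_norm_conj [Finite α] (Γ : Subgroup (FreeGroup α)) (C : ℤ) :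
    ∃ K : ℤ, ∀ t : FreeGroup α, (∀ γ ∈ Γ, gromov γ t⁻¹ ≤ C) → ∀ δ ∈ Γ, δ ≠ 1 →
      2 * (t.norm : ℤ) + δ.norm - K ≤ (t * δ * t⁻¹).norm := by
  have hex : ∀ δ : FreeGroup α, ∃ k : ℕ, δ ≠ 1 → C < (δ ^ 2 ^ k).norm := fun δ => by
    by_cases hδ : δ = 1
    · exact ⟨0, fun h => (h hδ).elim⟩
    · exact (exists_lt_norm_pow_two_pow hδ C).imp fun k hk _ => hk
  choose k hk using hex
  obtain ⟨B, hB⟩ := ((finite_norm_le (α := α) C).image fun δ => (2 ^ k δ * δ.norm : ℤ)).bddAbove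
  refine ⟨max (2 * C) (3 * C + B), fun t ht δ hδ hδ1 => ?_⟩
  by_cases hc : C < δ.norm
  · have := le_norm_conj_of_lt_norm (ht δ hδ) (ht δ⁻¹ (inv_mem hδ)) hc
    omega
  · have h1 := le_norm_conj_of_lt_norm (ht _ (pow_mem hδ (2 ^ k δ)))
      (ht _ (inv_mem (pow_mem hδ (2 ^ k δ)))) (hk δ hδ1)
    have h2 := norm_conj_pow_two_pow_le t δ (k δ)
    have h3 : (2 ^ k δ * δ.norm : ℤ) ≤ B := hB ⟨δ, not_lt.1 hc, rfl⟩
    omega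

end FreeGroup

/-! ### Normal forms in free products -/

/-- A list of pairs `(b₁, a₁), …, (bₙ, aₙ)` spells the word `b₁ a₁ ⋯ bₙ aₙ`. It is alternating if
all letters are nontrivial, except possibly the last one. -/
def IsAlternating {A B : Type*} [One A] [One B] : List (B × A) → Prop
  | [] => True
  | [p] => p.1 ≠ 1
  | p :: q :: L => p.1 ≠ 1 ∧ p.2 ≠ 1 ∧ IsAlternating (q :: L)

theorem IsAlternating.tail {A B : Type*} [One A] [One B] {p : B × A} {L : List (B × A)}
    (h : IsAlternating (p :: L)) : IsAlternating L := by
  rcases L with _ | ⟨q, L⟩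
  · trivial
  · exact h.2.2

theorem Monoid.Coprod.exists_isAlternating {A B : Type*} [Group A] [Group B] (x : A ∗ B) :
    ∃ (a : A) (L : List (B × A)), IsAlternating L ∧
      x = inl a * (L.map fun p => inr p.1 * inl p.2).prod := by
  induction x using Monoid.Coprod.induction_on' with
  | one => exact ⟨1, [], trivial, by simp⟩
  | inl_mul a x ih =>
    obtain ⟨a', L, hL, rfl⟩ := ih
    exact ⟨a * a', L, hL, by simp [mul_assoc]⟩
  | inr_mul b x ih =>
    obtain ⟨a, L, hL, rfl⟩ := ih
    by_cases hb : b = 1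
    · exact ⟨a, L, hL, by simp [hb]⟩
    rcases L with _ | ⟨⟨b', a'⟩, L⟩
    · exact ⟨1, [(b, a)], hb, by simp⟩
    by_cases ha : a = 1
    · subst ha
      by_cases hbb : b * b' = 1
      · refine ⟨a', L, hL.tail, ?_⟩
        rw [List.map_cons, List.prod_cons, map_one, one_mul, mul_assoc, ← mul_assoc,
          ← map_mul, hbb, map_one, one_mul]
      · refine ⟨1, (b * b', a') :: L, ?_, by simp [mul_assoc]⟩
        rcases L with _ | ⟨q, L⟩
        · exact hbb
        · exact ⟨hbb, hL.2⟩
    · exact ⟨1, (b, a) :: (b', a') :: L, ⟨hb, ha, hL⟩, by simp [mul_assoc]⟩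

section

variable {G : Type*} [Group G]

/-- The homomorphism from the abstract free product `Γ ∗ Γ` that is the inclusion of `Γ` on the
first factor and the inclusion followed by conjugation by `t` on the second. -/
def conjLift (Γ : Subgroup G) (t : G) : Γ ∗ Γ →* G :=
  Monoid.Coprod.lift Γ.subtype ((MulAut.conj t).toMonoidHom.comp Γ.subtype)

theorem range_conjLift (Γ : Subgroup G) (t : G) :
    (conjLift Γ t).range = Γ ⊔ MulAut.conj t • Γ := by
  rw [conjLift, Monoid.Coprod.range_lift, MonoidHom.range_comp, Subgroup.range_subtype]
  rfl

theorem isInternalFreeProduct_of_injective_conjLift {Γ : Subgroup G} {t : G}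
    (h : Function.Injective (conjLift Γ t)) :
    IsInternalFreeProduct Γ (MulAut.conj t • Γ) (Γ ⊔ MulAut.conj t • Γ) := by
  refine ⟨rfl, ?_⟩
  have e : Monoid.Coprod.lift Γ.subtype (MulAut.conj t • Γ).subtype = (conjLift Γ t).comp
      (MulEquiv.coprodCongr (.refl Γ) (Subgroup.equivSMul (MulAut.conj t) Γ).symm).toMonoidHom := by
    ext x
    · rfl
    · obtain ⟨y, rfl⟩ := (Subgroup.equivSMul (MulAut.conj t) Γ).surjective x
      simp [conjLift, MulEquiv.coprodCongr]
  rw [e]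
  exact h.comp (MulEquiv.injective _)

/-- The element `t β₁ t⁻¹ α₁ ⋯ t βₙ t⁻¹ αₙ` spelled by a list of pairs `(βᵢ, αᵢ)`. -/
def conjWord {Γ : Subgroup G} (t : G) (L : List (Γ × Γ)) : G :=
  (L.map fun p => t * p.1 * t⁻¹ * p.2).prod

theorem exists_conjLift_eq {Γ : Subgroup G} (t : G) (x : Γ ∗ Γ) :
    ∃ (γ : Γ) (L : List (Γ × Γ)), IsAlternating L ∧ conjLift Γ t x = γ * conjWord t L ∧
      (L = [] → x = Monoid.Coprod.inl γ) := by
  obtain ⟨γ, L, hL, rfl⟩ := Monoid.Coprod.exists_isAlternating x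
  refine ⟨γ, L, hL, ?_, ?_⟩
  · rw [map_mul, map_list_prod, List.map_map]
    simp [conjLift, conjWord, Function.comp_def]
  · rintro rfl; simp

theorem exists_eq_mul_conjWord {Γ : Subgroup G} {t x : G} (hx : x ∈ Γ ⊔ MulAut.conj t • Γ) :
    ∃ (γ : Γ) (L : List (Γ × Γ)), IsAlternating L ∧ x = γ * conjWord t L := by
  rw [← range_conjLift] at hx
  obtain ⟨y, rfl⟩ := hx
  obtain ⟨γ, L, hL, h, -⟩ := exists_conjLift_eq t y
  exact ⟨γ, L, hL, h⟩

end

/-! ### Ping-pong for a conjugating element transverse to a subgroup -/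

namespace FreeGroup

variable {α : Type*} [DecidableEq α]

/-- The element `t` is transverse to `Γ` with constant `M` if `Γ` fellow-travels the geodesics from
`1` to `t` and to `t⁻¹` for a time at most `M / 2`, and if conjugating a nontrivial element of `Γ`
by `t` or `t⁻¹` adds `2|t|` to its length, up to an error `M`. -/
structure IsTransverse (Γ : Subgroup (FreeGroup α)) (t : FreeGroup α) (M : ℤ) : Prop where
  gromov_le : ∀ γ ∈ Γ, gromov γ t ≤ M
  gromov_inv_le : ∀ γ ∈ Γ, gromov γ t⁻¹ ≤ M
  le_norm_conj : ∀ γ ∈ Γ, γ ≠ 1 → 2 * (t.norm : ℤ) + γ.norm - M ≤ (t * γ * t⁻¹).norm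
  le_norm_conj_inv : ∀ γ ∈ Γ, γ ≠ 1 → 2 * (t.norm : ℤ) + γ.norm - M ≤ (t⁻¹ * γ * t).norm

namespace IsTransverse

variable {Γ : Subgroup (FreeGroup α)} {t : FreeGroup α} {M : ℤ}

theorem inv (h : IsTransverse Γ t M) : IsTransverse Γ t⁻¹ M where
  gromov_le := h.gromov_inv_le
  gromov_inv_le := by simpa using h.gromov_le
  le_norm_conj := by simpa using h.le_norm_conj_inv
  le_norm_conj_inv := by simpa using h.le_norm_conj

theorem nonneg (h : IsTransverse Γ t M) : 0 ≤ M := by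
  simpa [gromov] using h.gromov_le 1 (one_mem _)

/-- Local-to-global step: if `y` starts like `t⁻¹`, then `t * δ * y` starts like `t`, and almost no
cancellation occurs in this product. -/
theorem step (h : IsTransverse Γ t M) (ht : 3 * M < 2 * t.norm) {δ : FreeGroup α} (hδ : δ ∈ Γ)
    (hδ1 : δ ≠ 1) {y : FreeGroup α} (hy : 2 * (t.norm : ℤ) - 2 * M ≤ gromov t⁻¹ y) :
    (t.norm : ℤ) + δ.norm + y.norm - 2 * M ≤ (t * δ * y).norm ∧
      2 * (t.norm : ℤ) - 2 * M ≤ gromov t (t * δ * y) := by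
  have n : t⁻¹.norm = t.norm := norm_inv_eq
  have n' : δ⁻¹.norm = δ.norm := norm_inv_eq
  have c := h.le_norm_conj δ hδ hδ1
  have e1 := norm_mul_eq_sub_gromov (t * δ) t⁻¹
  have e2 := norm_mul_le t δ
  have e3 := norm_mul_eq_sub_gromov (t * δ) y
  have u := gromov_ultrametric (t * δ)⁻¹ y t⁻¹
  have s := gromov_comm t⁻¹ y
  have e4 := norm_mul_eq_sub_gromov t δ
  have g := h.gromov_inv_le δ hδ
  have s' := gromov_comm t⁻¹ δ
  have e5 := gromov_mul_right t (δ * y)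
  have e6 := norm_mul_le δ y
  rw [← mul_assoc] at e5
  omega

theorem step_last (h : IsTransverse Γ t M) {δ : FreeGroup α} (hδ : δ ∈ Γ) :
    (t.norm : ℤ) + δ.norm - M ≤ (t * δ).norm ∧ 2 * (t.norm : ℤ) - 2 * M ≤ gromov t (t * δ) := by
  have e4 := norm_mul_eq_sub_gromov t δ
  have g := h.gromov_inv_le δ hδ
  have s' := gromov_comm t⁻¹ δ
  have e5 := gromov_mul_right t δ
  have := h.nonneg
  omega

theorem step_first (h : IsTransverse Γ t M) (ht : 3 * M < 2 * t.norm) {δ : FreeGroup α}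
    (hδ : δ ∈ Γ) {y : FreeGroup α} (hy : 2 * (t.norm : ℤ) - 2 * M ≤ gromov t y) :
    (δ.norm : ℤ) + y.norm - M ≤ (δ * y).norm := by
  have e := norm_mul_eq_sub_gromov δ y
  have g := h.gromov_le δ⁻¹ (inv_mem hδ)
  have u := gromov_ultrametric δ⁻¹ y t
  have s := gromov_comm t y
  omega

theorem le_norm_conjWord (h : IsTransverse Γ t M) {E : ℤ} (hE : 0 ≤ E)
    (ht : 5 * M + E < 2 * t.norm) (L : List (Γ × Γ)) (hL : IsAlternating L) (hne : L ≠ []) :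
    M + (L.map fun p => ((p.1 : FreeGroup α).norm + (p.2 : FreeGroup α).norm + E : ℤ)).sum ≤
        (conjWord t L).norm ∧
      2 * (t.norm : ℤ) - 2 * M ≤ gromov t (conjWord t L) := by
  have hM := h.nonneg
  induction L with
  | nil => exact (hne rfl).elim
  | cons p L ih =>
    obtain ⟨β, a⟩ := p
    have n : t⁻¹.norm = t.norm := norm_inv_eq
    rcases L with _ | ⟨q, L⟩
    · have hβ : (β : FreeGroup α) ≠ 1 := by simpa [IsAlternating] using hL
      obtain ⟨h1, h2⟩ := h.inv.step_last a.2
      obtain ⟨h3, h4⟩ := h.step (by omega) β.2 hβ (y := t⁻¹ * a) (by omega)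
      simp only [conjWord, List.map_cons, List.map_nil, List.prod_singleton, List.sum_singleton]
      rw [mul_assoc (t * (β : FreeGroup α))]
      omega
    · have hβ : (β : FreeGroup α) ≠ 1 := by simpa using hL.1
      have ha : (a : FreeGroup α) ≠ 1 := by simpa using hL.2.1
      obtain ⟨i1, i2⟩ := ih hL.2.2 (by simp)
      obtain ⟨h1, h2⟩ := h.inv.step (by omega) a.2 ha (y := conjWord t (q :: L))
        (by rw [inv_inv]; omega)
      obtain ⟨h3, h4⟩ := h.step (by omega) β.2 hβ (y := t⁻¹ * a * conjWord t (q :: L)) (by omega)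
      have e : conjWord t ((β, a) :: q :: L) = t * β * (t⁻¹ * a * conjWord t (q :: L)) := by
        simp [conjWord, mul_assoc]
      rw [e, List.map_cons, List.sum_cons]
      dsimp only
      omega

/-- The length of an element of `⟨Γ, t Γ t⁻¹⟩` in normal form is at least the sum of the lengths of
its letters, plus `E` for each letter from `t Γ t⁻¹`. -/
theorem le_norm_mul_conjWord (h : IsTransverse Γ t M) {E : ℤ} (hE : 0 ≤ E)
    (ht : 5 * M + E < 2 * t.norm) (γ : Γ) (L : List (Γ × Γ)) (hL : IsAlternating L) :
    (γ : FreeGroup α).norm +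
      (L.map fun p => ((p.1 : FreeGroup α).norm + (p.2 : FreeGroup α).norm + E : ℤ)).sum ≤
        (γ * conjWord t L).norm := by
  rcases eq_or_ne L [] with rfl | hne
  · simp [conjWord]
  · have hM := h.nonneg
    obtain ⟨h1, h2⟩ := h.le_norm_conjWord hE ht L hL hne
    have := h.step_first (by omega) γ.2 h2
    omega

theorem le_norm_mul_conjWord_of_ne_nil (h : IsTransverse Γ t M) {E : ℤ} (hE : 0 ≤ E)
    (ht : 5 * M + E < 2 * t.norm) (γ : Γ) {L : List (Γ × Γ)} (hL : IsAlternating L) (hne : L ≠ []) :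
    E ≤ (γ * conjWord t L).norm := by
  have h1 := h.le_norm_mul_conjWord hE ht γ L hL
  obtain ⟨p, L, rfl⟩ := List.exists_cons_of_ne_nil hne
  have h2 : 0 ≤ (L.map fun p =>
      ((p.1 : FreeGroup α).norm + (p.2 : FreeGroup α).norm + E : ℤ)).sum :=
    List.sum_nonneg (by simp only [List.mem_map]; rintro _ ⟨p, -, rfl⟩; positivity)
  rw [List.map_cons, List.sum_cons] at h1
  omega

theorem injective_conjLift (h : IsTransverse Γ t M) (ht : 5 * M + 1 < 2 * t.norm) :
    Function.Injective (conjLift Γ t) := by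
  rw [injective_iff_map_eq_one]
  intro x hx
  obtain ⟨γ, L, hL, he, hnil⟩ := exists_conjLift_eq t x
  rw [hx] at he
  rcases eq_or_ne L [] with rfl | hne
  · have : γ = 1 := by simpa [conjWord, eq_comm] using he
    rw [hnil rfl, this, _root_.map_one]
  · have := h.le_norm_mul_conjWord_of_ne_nil zero_le_one ht γ hL hne
    rw [← he, norm_one] at this
    simp at this

/-- The elements of `⟨Γ, t Γ t⁻¹⟩` outside `Γ` are long. -/
theorem notMem_sup_conj (h : IsTransverse Γ t M) {x : FreeGroup α} (hx : x ∉ Γ)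
    (ht : 5 * M + (x.norm + 1) < 2 * t.norm) : x ∉ Γ ⊔ MulAut.conj t • Γ := by
  intro hmem
  obtain ⟨γ, L, hL, he⟩ := exists_eq_mul_conjWord hmem
  rcases eq_or_ne L [] with rfl | hne
  · apply hx
    simp [he, conjWord]
  · have := h.le_norm_mul_conjWord_of_ne_nil (by positivity) ht γ hL hne
    rw [← he] at this
    omega

theorem conj_notMem_sup_conj (h : IsTransverse Γ t M) {x : FreeGroup α} (hx : x ∉ Γ)
    (ht : 5 * M + (x.norm + 1) < 2 * t.norm) : t * x * t⁻¹ ∉ Γ ⊔ MulAut.conj t • Γ := by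
  intro hmem
  apply h.inv.notMem_sup_conj hx (by rwa [norm_inv_eq])
  have := Subgroup.smul_mem_pointwise_smul (t * x * t⁻¹) (MulAut.conj t⁻¹) _ hmem
  rw [Subgroup.smul_sup, smul_smul, ← _root_.map_mul, inv_mul_cancel, _root_.map_one, one_smul,
    sup_comm] at this
  simpa [mul_assoc] using this

end IsTransverse

/-- If no positive power of `g` lies in the finitely generated subgroup `Γ`, there are arbitrarily
large powers of `g` that are transverse to `Γ` with the same constant. -/
theorem exists_isTransverse_pow [Finite α] {Γ : Subgroup (FreeGroup α)} (hΓ : Γ.FG)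
    {g : FreeGroup α} (hg : ∀ k : ℕ, 1 ≤ k → g ^ k ∉ Γ) :
    ∃ M : ℤ, ∀ N : ℕ, ∃ m : ℕ, N ≤ m ∧ N ≤ (g ^ m).norm ∧ IsTransverse Γ (g ^ m) M := by
  have hg1 : g ≠ 1 := by
    rintro rfl
    exact hg 1 le_rfl (by simp)
  obtain ⟨k, hk⟩ := exists_norm_pow_two_pow_lt hg1
  set h := g ^ 2 ^ k with hdef
  have hpow : ∀ j : ℕ, 1 ≤ j → h ^ j ∉ Γ := fun j hj => by
    rw [hdef, ← pow_mul]
    exact hg _ (Nat.mul_pos (by positivity) hj)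
  have hk' : h⁻¹.norm < (h⁻¹ ^ 2).norm := by rwa [inv_pow, norm_inv_eq, norm_inv_eq]
  have hpow' : ∀ j : ℕ, 1 ≤ j → h⁻¹ ^ j ∉ Γ := fun j hj => by
    rw [inv_pow, inv_mem_iff]; exact hpow j hj
  obtain ⟨C₁, hC₁⟩ := exists_gromov_pow_le hΓ hk hpow
  obtain ⟨C₂, hC₂⟩ := exists_gromov_pow_le hΓ hk' hpow'
  obtain ⟨K₁, hK₁⟩ := exists_le_norm_conj Γ C₁
  obtain ⟨K₂, hK₂⟩ := exists_le_norm_conj Γ C₂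
  refine ⟨max (max C₁ C₂) (max K₁ K₂), fun N => ⟨2 ^ k * N, Nat.le_mul_of_pos_left _ (by positivity),
    ?_, ?_⟩⟩
  · rw [pow_mul]; exact le_norm_pow_of_norm_lt hk N
  · rw [pow_mul, ← hdef]
    have h1 : ∀ γ ∈ Γ, gromov γ (h ^ N) ≤ C₁ := fun γ hγ => hC₁ γ hγ N
    have h2 : ∀ γ ∈ Γ, gromov γ (h ^ N)⁻¹ ≤ C₂ := fun γ hγ => by
      rw [← inv_pow]; exact hC₂ γ hγ N
    refine ⟨fun γ hγ => ?_, fun γ hγ => ?_, fun γ hγ hγ1 => ?_, fun γ hγ hγ1 => ?_⟩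
    · have := h1 γ hγ; omega
    · have := h2 γ hγ; omega
    · have := hK₂ (h ^ N) h2 γ hγ hγ1; omega
    · have := hK₁ (h ^ N)⁻¹ (by simpa using h1) γ hγ hγ1
      rw [norm_inv_eq, inv_inv] at this; omega

end FreeGroup

/-! ### Distances in the Cayley tree -/

theorem exists_walk_cayleyTree {d : ℕ} (L : List (Fin d × Bool)) (u : FreeGroup (Fin d)) :
    ∃ p : (cayleyTree d).Walk u (u * FreeGroup.mk L), p.length = L.length := by
  induction L generalizing u with
  | nil =>
    exact ⟨SimpleGraph.Walk.nil.copy rfl (by rw [← FreeGroup.one_eq_mk, mul_one]), by simp⟩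
  | cons a L ih =>
    obtain ⟨p, hp⟩ := ih (u * FreeGroup.mk [a])
    have hadj : (cayleyTree d).Adj u (u * FreeGroup.mk [a]) := by
      rw [cayleyTree, SimpleGraph.mulCayley_adj']
      refine ⟨?_, FreeGroup.of a.1, ⟨_, rfl⟩, ?_⟩
      · intro h
        have h1 : FreeGroup.mk [a] = 1 := by simpa using h
        have h2 := congrArg FreeGroup.toWord h1
        simp at h2
      · obtain ⟨i, _ | _⟩ := a
        · right
          have : FreeGroup.mk [(i, false)] = (FreeGroup.of i)⁻¹ := rfl
          rw [this, inv_mul_cancel_right]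
        · left; rfl
    have e : u * FreeGroup.mk [a] * FreeGroup.mk L = u * FreeGroup.mk (a :: L) := by
      rw [mul_assoc, FreeGroup.mul_mk, List.singleton_append]
    exact ⟨(SimpleGraph.Walk.cons hadj p).copy rfl e, by simp [hp]⟩

theorem norm_inv_mul_le_length {d : ℕ} {u v : FreeGroup (Fin d)} (p : (cayleyTree d).Walk u v) :
    (u⁻¹ * v).norm ≤ p.length := by
  induction p with
  | nil => simp
  | @cons u v w h p ih =>
    rw [cayleyTree, SimpleGraph.mulCayley_adj'] at h
    obtain ⟨-, _, ⟨i, rfl⟩, h⟩ := h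
    have h1 : (u⁻¹ * v).norm ≤ 1 := by
      rcases h with rfl | rfl
      · simp
      · simp [FreeGroup.norm_inv_eq]
    have h2 := FreeGroup.norm_mul_le (u⁻¹ * v) (v⁻¹ * w)
    rw [mul_assoc, mul_inv_cancel_left] at h2
    rw [SimpleGraph.Walk.length_cons]
    omega

theorem dist_cayleyTree_one {d : ℕ} (x : FreeGroup (Fin d)) :
    (cayleyTree d).dist 1 x = x.norm := by
  obtain ⟨p, hp⟩ := exists_walk_cayleyTree x.toWord 1
  obtain ⟨q, hq⟩ := p.reachable.exists_walk_length_eq_dist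
  have h1 := norm_inv_mul_le_length q
  have h2 := (SimpleGraph.dist_le p).trans hp.le
  rw [hq, inv_one, one_mul] at h1
  rw [one_mul, FreeGroup.mk_toWord] at h1 h2
  exact le_antisymm h2 h1

/-! ### Poincaré series -/

namespace FreeGroup

variable {α : Type*} [DecidableEq α]

/-- The term `exp (-s |x|)` of the Poincaré series. Using `ℝ≥0∞` allows to sum without discussing
convergence. -/
noncomputable def poincareTerm (s : ℝ) (x : FreeGroup α) : ℝ≥0∞ :=
  ENNReal.ofReal (Real.exp (-s * x.norm))

/-- The Poincaré series of a subgroup, with values in `[0, ∞]`. -/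
noncomputable def poincareSeries (s : ℝ) (Γ : Subgroup (FreeGroup α)) : ℝ≥0∞ :=
  ∑' γ : Γ, poincareTerm s (γ : FreeGroup α)

theorem poincareSeries_ne_top_iff {s : ℝ} {Γ : Subgroup (FreeGroup α)} :
    poincareSeries s Γ ≠ ∞ ↔
      Summable fun γ : Γ => Real.exp (-s * (γ : FreeGroup α).norm) := by
  refine ⟨fun h => ?_, fun h => h.tsum_ofReal_ne_top⟩
  refine (ENNReal.summable_toReal h).congr fun γ => ?_
  exact (ENNReal.toReal_ofReal (Real.exp_nonneg _))

theorem poincareSeries_mono (s : ℝ) {Γ Δ : Subgroup (FreeGroup α)} (h : Γ ≤ Δ) :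
    poincareSeries s Γ ≤ poincareSeries s Δ :=
  ENNReal.tsum_comp_le_tsum_of_injective (Subgroup.inclusion_injective h)
    fun γ : Δ => poincareTerm s (γ : FreeGroup α)

end FreeGroup

theorem ENNReal.tsum_pi_fin_prod {X : Type*} (f : X → ℝ≥0∞) (n : ℕ) :
    ∑' v : Fin n → X, ∏ i, f (v i) = (∑' x, f x) ^ n := by
  induction n with
  | zero => simp
  | succ n ih =>
    rw [← (Fin.consEquiv fun _ => X).tsum_eq, ENNReal.tsum_prod']
    simp only [Fin.consEquiv_apply, Fin.prod_univ_succ, Fin.cons_zero, Fin.cons_succ,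
      ENNReal.tsum_mul_left, ENNReal.tsum_mul_right, ih]
    rw [pow_succ']

/-- Summing a multiplicative weight over all finite words gives a geometric series. If the weights sum
to at least `1`, truncated subtraction makes both sides infinite. -/
theorem ENNReal.tsum_list_prod {X : Type*} (f : X → ℝ≥0∞) :
    ∑' L : List X, (L.map f).prod = (1 - ∑' x, f x)⁻¹ := by
  rw [← List.equivSigmaTuple.symm.tsum_eq, ENNReal.tsum_sigma', ← ENNReal.tsum_geometric]
  refine tsum_congr fun n => ?_
  rw [← ENNReal.tsum_pi_fin_prod]
  refine tsum_congr fun v => ?_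
  simp [List.equivSigmaTuple, List.map_ofFn, List.prod_ofFn]

namespace FreeGroup

variable {α : Type*} [DecidableEq α]

theorem poincareSeries_top_ne_top [Finite α] :
    ∃ s : ℝ, 0 < s ∧ poincareSeries s (⊤ : Subgroup (FreeGroup α)) ≠ ∞ := by
  have hterm : ∀ (s : ℝ) (x : FreeGroup α), poincareTerm s x =
      (x.toWord.map fun _ => ENNReal.ofReal (Real.exp (-s))).prod := fun s x => by
    rw [List.map_const', List.prod_replicate, ← ENNReal.ofReal_pow (Real.exp_nonneg _),
      ← Real.exp_nat_mul, poincareTerm, norm]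
    ring_nf
  have htend : Filter.Tendsto
      (fun s : ℝ => ∑' _ : α × Bool, ENNReal.ofReal (Real.exp (-s))) Filter.atTop (𝓝 0) := by
    have h1 : Filter.Tendsto (fun s : ℝ => ENNReal.ofReal (Real.exp (-s))) Filter.atTop (𝓝 0) := by
      simpa using ENNReal.tendsto_ofReal
        (Real.tendsto_exp_atBot.comp Filter.tendsto_neg_atTop_atBot)
    simp only [ENNReal.tsum_const]
    simpa using ENNReal.Tendsto.const_mul (a := (ENat.card (α × Bool) : ℝ≥0∞)) h1
      (Or.inr (by simp [ENNReal.mul_eq_top, ‹Finite α›]))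
  obtain ⟨s, hs1, hs0⟩ := ((htend.eventually_lt_const one_pos).and
    (Filter.eventually_gt_atTop 0)).exists
  refine ⟨s, hs0, ne_top_of_le_ne_top (b := (1 - ∑' _ : α × Bool, ENNReal.ofReal (Real.exp (-s)))⁻¹)
    ?_ ?_⟩
  · simpa using (tsub_pos_of_lt hs1).ne'
  · rw [← ENNReal.tsum_list_prod]
    refine (le_of_eq ?_).trans (ENNReal.tsum_comp_le_tsum_of_injective
      (toWord_injective.comp (Subtype.val_injective (p := fun x => x ∈ (⊤ : Subgroup _)))) _)
    exact tsum_congr fun x => hterm s x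

/-- The Poincaré series of `⟨Γ, t Γ t⁻¹⟩` is dominated by the sum over normal forms of the product of
the terms of their letters, which is a geometric series. -/
theorem IsTransverse.poincareSeries_sup_conj_le {Γ : Subgroup (FreeGroup α)} {t : FreeGroup α}
    {M : ℤ} (h : IsTransverse Γ t M) {E : ℕ} (ht : 5 * M + E < 2 * t.norm) {s : ℝ} (hs : 0 < s) :
    poincareSeries s (Γ ⊔ MulAut.conj t • Γ) ≤ poincareSeries s Γ *
      (1 - poincareSeries s Γ * poincareSeries s Γ * ENNReal.ofReal (Real.exp (-s * E)))⁻¹ := by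
  set c := ENNReal.ofReal (Real.exp (-s * E))
  have hex : ∀ x : (Γ ⊔ MulAut.conj t • Γ : Subgroup (FreeGroup α)), ∃ y : Γ × List (Γ × Γ),
      IsAlternating y.2 ∧ (x : FreeGroup α) = y.1 * conjWord t y.2 := fun x => by
    obtain ⟨γ, L, h1, h2⟩ := exists_eq_mul_conjWord x.2
    exact ⟨(γ, L), h1, h2⟩
  choose y hy hxy using hex
  let w : Γ × Γ → ℝ≥0∞ := fun p => poincareTerm s (p.1 : FreeGroup α) *
    poincareTerm s (p.2 : FreeGroup α) * c
  have hw : ∀ L : List (Γ × Γ), (L.map w).prod = ENNReal.ofReal (Real.exp (-s *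
      ((L.map fun p => ((p.1 : FreeGroup α).norm + (p.2 : FreeGroup α).norm + E : ℤ)).sum : ℤ))) :=
    fun L => by
      induction L with
      | nil => simp
      | cons p L ih =>
        rw [List.map_cons, List.prod_cons, ih, List.map_cons, List.sum_cons]
        simp only [w, c, poincareTerm]
        rw [← ENNReal.ofReal_mul (by positivity), ← ENNReal.ofReal_mul (by positivity),
          ← ENNReal.ofReal_mul (by positivity), ← Real.exp_add, ← Real.exp_add, ← Real.exp_add]
        rw [Int.cast_add, Int.cast_add, Int.cast_add, Int.cast_natCast, Int.cast_natCast,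
          Int.cast_natCast]
        congr 2
        ring
  calc poincareSeries s (Γ ⊔ MulAut.conj t • Γ)
      ≤ ∑' x, poincareTerm s ((y x).1 : FreeGroup α) * ((y x).2.map w).prod := by
        refine ENNReal.tsum_le_tsum fun x => ?_
        have h1 := h.le_norm_mul_conjWord (by positivity) ht (y x).1 (y x).2 (hy x)
        rw [hw, poincareTerm, poincareTerm, ← ENNReal.ofReal_mul (by positivity), ← Real.exp_add,
          hxy x]
        refine ENNReal.ofReal_le_ofReal (Real.exp_le_exp.2 ?_)
        have h2 := (Int.cast_le (R := ℝ)).2 h1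
        rw [Int.cast_add, Int.cast_natCast, Int.cast_natCast] at h2
        nlinarith
    _ ≤ ∑' z : Γ × List (Γ × Γ), poincareTerm s (z.1 : FreeGroup α) * (z.2.map w).prod :=
        ENNReal.tsum_comp_le_tsum_of_injective (f := y) (fun a b hab => Subtype.ext <| by
          rw [hxy a, hxy b, hab]) fun z => poincareTerm s (z.1 : FreeGroup α) * (z.2.map w).prod
    _ = _ := by
        rw [ENNReal.tsum_prod']
        simp only [ENNReal.tsum_mul_left, ENNReal.tsum_mul_right, ENNReal.tsum_list_prod]
        simp only [w, ENNReal.tsum_prod', ENNReal.tsum_mul_left, ENNReal.tsum_mul_right]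
        rfl

/-- One step of the construction: after conjugating by a suitable power of `g`, the free product of
`Γ` with its conjugate avoids a given finite set, and its Poincaré series is barely larger. -/
theorem exists_pow_isInternalFreeProduct [Finite α] {Γ : Subgroup (FreeGroup α)} (hΓ : Γ.FG)
    {g : FreeGroup α} (hg : ∀ k : ℕ, 1 ≤ k → g ^ k ∉ Γ) (S : Finset (FreeGroup α))
    (hS : ∀ x ∈ S, x ∉ Γ) {s : ℝ} (hs : 0 < s) {B : ℝ≥0∞} (hB : poincareSeries s Γ < B) (N : ℕ) :
    ∃ m : ℕ, N ≤ m ∧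
      IsInternalFreeProduct Γ (MulAut.conj (g ^ m) • Γ) (Γ ⊔ MulAut.conj (g ^ m) • Γ) ∧
      (∀ x ∈ S, x ∉ Γ ⊔ MulAut.conj (g ^ m) • Γ ∧
        g ^ m * x * (g ^ m)⁻¹ ∉ Γ ⊔ MulAut.conj (g ^ m) • Γ) ∧
      poincareSeries s (Γ ⊔ MulAut.conj (g ^ m) • Γ) < B := by
  obtain ⟨M, hM⟩ := exists_isTransverse_pow hΓ hg
  set P := poincareSeries s Γ
  have hP : P ≠ ∞ := hB.ne_top
  have htend : Filter.Tendsto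
      (fun E : ℕ => P * (1 - P * P * ENNReal.ofReal (Real.exp (-s * E)))⁻¹)
      Filter.atTop (𝓝 P) := by
    have h1 : Filter.Tendsto (fun E : ℕ => ENNReal.ofReal (Real.exp (-s * E)))
        Filter.atTop (𝓝 0) := by
      simpa using ENNReal.tendsto_ofReal (Real.tendsto_exp_atBot.comp
        (tendsto_natCast_atTop_atTop.const_mul_atTop_of_neg (neg_lt_zero.2 hs)))
    have h2 := ENNReal.Tendsto.const_mul h1 (a := P * P) (Or.inr (ENNReal.mul_ne_top hP hP))
    have h3 := ENNReal.Tendsto.const_mul (a := P)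
      ((ENNReal.Tendsto.sub tendsto_const_nhds h2 (Or.inl ENNReal.one_ne_top)).inv) (Or.inr hP)
    simpa using h3
  obtain ⟨E, hE⟩ := (htend.eventually_lt_const hB).exists
  obtain ⟨R, hR⟩ := (S.image norm).bddAbove
  obtain ⟨m, hNm, hm, ht⟩ := hM (N + E + R + (5 * M).toNat + 2)
  refine ⟨m, by omega, isInternalFreeProduct_of_injective_conjLift (ht.injective_conjLift
    (by omega)), fun x hx => ?_, (ht.poincareSeries_sup_conj_le (E := E) (by omega) hs).trans_lt hE⟩
  have : x.norm ≤ R := hR (by simpa using ⟨x, hx, rfl⟩)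
  exact ⟨ht.notMem_sup_conj (hS x hx) (by omega), ht.conj_notMem_sup_conj (hS x hx) (by omega)⟩

end FreeGroup

/-! ### The Chabauty topology -/

section

variable {G : Type*} [Group G]

theorem Subgroup.tendsto_chabauty_iff {ι : Type*} {l : Filter ι} {f : ι → Subgroup G}
    {Δ : Subgroup G} :
    Filter.Tendsto f l (𝓝 Δ) ↔ ∀ x, ∀ᶠ k in l, (x ∈ f k ↔ x ∈ Δ) := by
  rw [nhds_induced, Filter.tendsto_comap_iff, tendsto_pi_nhds]
  simp [nhds_discrete]

/-- Among the subgroups containing `Γ`, those avoiding a suitable finite set are in a given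
neighbourhood of `Γ`. -/
theorem Subgroup.exists_finset_of_mem_nhds {Γ : Subgroup G} {O : Set (Subgroup G)} (hO : O ∈ 𝓝 Γ) :
    ∃ S : Finset G, (∀ x ∈ S, x ∉ Γ) ∧ ∀ Δ, Γ ≤ Δ → (∀ x ∈ S, x ∉ Δ) → Δ ∈ O := by
  classical
  rw [nhds_induced, Filter.mem_comap] at hO
  obtain ⟨U, hU, hUO⟩ := hO
  rw [nhds_pi, Filter.mem_pi] at hU
  obtain ⟨I, hI, V, hV, hVU⟩ := hU
  refine ⟨hI.toFinset.filter (· ∉ Γ), fun x hx => (Finset.mem_filter.1 hx).2,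
    fun Δ hle hΔ => hUO (hVU fun i hi => ?_)⟩
  have : i ∈ Δ ↔ i ∈ Γ := by
    refine ⟨fun h => ?_, fun h => hle h⟩
    by_contra h'
    exact hΔ i (Finset.mem_filter.2 ⟨hI.mem_toFinset.2 hi, h'⟩) h
  have hm := mem_of_mem_nhds (hV i)
  change decide (i ∈ Δ) ∈ V i
  rwa [decide_eq_decide.2 this]

end

/-! ### Stages of the construction -/

namespace FreeGroup

variable {α : Type*} [DecidableEq α]

/-- A stage of the construction: a finitely generated subgroup with Poincaré series less than `B`,
and a finite set of elements that it avoids and that all later stages have to avoid. -/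
structure IsStage (s : ℝ) (B : ℝ≥0∞) (p : Subgroup (FreeGroup α) × Finset (FreeGroup α)) :
    Prop where
  fg : p.1.FG
  notMem : ∀ x ∈ p.2, x ∉ p.1
  poincareSeries_lt : poincareSeries s p.1 < B

/-- Each stage has a successor. All elements of `T` that are not in the current subgroup are
excluded from now on, and so are their conjugates by `g ^ m`; thus the subgroup constructed eventually
agrees on `T` with its conjugate by `g ^ (-m)`. -/
theorem IsStage.exists_succ [Finite α] {s : ℝ} (hs : 0 < s) {B : ℝ≥0∞}
    {p : Subgroup (FreeGroup α) × Finset (FreeGroup α)} (hp : IsStage s B p) (g : FreeGroup α)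
    (T : Finset (FreeGroup α)) (N : ℕ) :
    ∃ (p' : Subgroup (FreeGroup α) × Finset (FreeGroup α)) (m : ℕ), IsStage s B p' ∧
      p.1 ≤ p'.1 ∧ p.2 ⊆ p'.2 ∧ IsFreeProductStep g m p.1 p'.1 ∧
      (∀ x ∈ T, x ∉ p.1 → x ∈ p'.2) ∧
      ((∀ k : ℕ, 1 ≤ k → g ^ k ∉ p.1) → N ≤ m ∧ MulAut.conj (g ^ m) • p.1 ≤ p'.1 ∧
        ∀ x ∈ T, x ∉ p.1 → g ^ m * x * (g ^ m)⁻¹ ∈ p'.2) := by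
  classical
  obtain ⟨Γ, S⟩ := p
  set S' := S ∪ T.filter (· ∉ Γ) with hS'
  have hS'Γ : ∀ x ∈ S', x ∉ Γ := by
    intro x hx
    rcases Finset.mem_union.1 hx with h | h
    · exact hp.notMem x h
    · exact (Finset.mem_filter.1 h).2
  by_cases hg : ∀ k : ℕ, 1 ≤ k → g ^ k ∉ Γ
  · obtain ⟨m, hm, hfree, hexcl, hlt⟩ := exists_pow_isInternalFreeProduct hp.fg hg S' hS'Γ hs
      hp.poincareSeries_lt (max N 1)
    refine ⟨(Γ ⊔ MulAut.conj (g ^ m) • Γ, S' ∪ S'.image fun x => g ^ m * x * (g ^ m)⁻¹), m,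
      ⟨?_, ?_, hlt⟩, le_sup_left, ?_, ⟨?_, ?_⟩, ?_, fun _ => ⟨by omega, le_sup_right, ?_⟩⟩
    · obtain ⟨F, rfl : Subgroup.closure _ = Γ⟩ := hp.fg
      refine hp.fg.sup ⟨F.image (MulAut.conj (g ^ m)), ?_⟩
      rw [Finset.coe_image]
      exact (MonoidHom.map_closure (MulAut.conj (g ^ m)).toMonoidHom (F : Set (FreeGroup α))).symm
    · intro x hx
      rcases Finset.mem_union.1 hx with h | h
      · exact (hexcl x h).1
      · obtain ⟨y, hy, rfl⟩ := Finset.mem_image.1 h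
        exact (hexcl y hy).2
    · exact Finset.subset_union_left.trans Finset.subset_union_left
    · rintro ⟨k, hk, h⟩
      exact (hg k hk h).elim
    · exact fun _ => ⟨by omega, hfree⟩
    · intro x hx hxΓ
      exact Finset.mem_union_left _ (Finset.mem_union_right _ (Finset.mem_filter.2 ⟨hx, hxΓ⟩))
    · intro x hx hxΓ
      exact Finset.mem_union_right _ (Finset.mem_image_of_mem _
        (Finset.mem_union_right _ (Finset.mem_filter.2 ⟨hx, hxΓ⟩)))
  · refine ⟨(Γ, S'), 0, ⟨hp.fg, hS'Γ, hp.poincareSeries_lt⟩, le_rfl, Finset.subset_union_left,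
      ⟨fun _ => rfl, fun h => ?_⟩, ?_, fun h => (hg h).elim⟩
    · push Not at hg
      exact (h hg).elim
    · intro x hx hxΓ
      exact Finset.mem_union_right _ (Finset.mem_filter.2 ⟨hx, hxΓ⟩)

end FreeGroup

/-- To be a boomerang subgroup it suffices that, for each `g` no positive power of which lies in
`Δ`, conjugation by arbitrarily large powers of `g` preserves membership in `Δ` for the elements of
any given finite set. -/
theorem isBoomerang_of_forall {G : Type*} [Group G] {Δ : Subgroup G} {e : ℕ → G}
    (he : Function.Surjective e)
    (h : ∀ g : G, (∀ k : ℕ, 1 ≤ k → g ^ k ∉ Δ) → ∀ N : ℕ, ∃ m, N ≤ m ∧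
      ∀ i ≤ N, (g ^ m * e i * (g ^ m)⁻¹ ∈ Δ ↔ e i ∈ Δ)) : IsBoomerang Δ := by
  intro g
  by_cases hg : ∀ k : ℕ, 1 ≤ k → g ^ k ∉ Δ
  · have hg' : ∀ k : ℕ, 1 ≤ k → g⁻¹ ^ k ∉ Δ := fun k hk => by
      rw [inv_pow, inv_mem_iff]; exact hg k hk
    choose n hn hiff using h g⁻¹ hg'
    refine ⟨n, Filter.tendsto_atTop_mono hn Filter.tendsto_id,
      Subgroup.tendsto_chabauty_iff.2 fun x => ?_⟩
    obtain ⟨i, rfl⟩ := he x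
    filter_upwards [Filter.eventually_ge_atTop i] with k hk
    rw [← hiff k i hk, Subgroup.mem_pointwise_smul_iff_inv_smul_mem, ← map_inv, ← inv_pow]
    rfl
  · push Not at hg
    obtain ⟨k, hk, hmem⟩ := hg
    refine ⟨fun j => k * j, Filter.tendsto_id.const_mul_atTop' hk, ?_⟩
    simp only [pow_mul, Subgroup.conj_smul_eq_self_of_mem (pow_mem hmem _)]
    exact tendsto_const_nhds

/-! ### Critical exponents -/

section

variable {d : ℕ} {Γ Δ : Subgroup (FreeGroup (Fin d))}

theorem criticalExponent_eq (Γ : Subgroup (FreeGroup (Fin d))) :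
    criticalExponent Γ = sInf {s : ℝ | 0 < s ∧ FreeGroup.poincareSeries s Γ ≠ ∞} := by
  simp only [criticalExponent, criticalExponentAt, FreeGroup.poincareSeries_ne_top_iff,
    smul_eq_mul, mul_one, dist_cayleyTree_one]

theorem exists_poincareSeries_ne_top (Γ : Subgroup (FreeGroup (Fin d))) :
    {s : ℝ | 0 < s ∧ FreeGroup.poincareSeries s Γ ≠ ∞}.Nonempty := by
  obtain ⟨s, hs, h⟩ := FreeGroup.poincareSeries_top_ne_top (α := Fin d)
  exact ⟨s, hs, ne_top_of_le_ne_top h (FreeGroup.poincareSeries_mono s le_top)⟩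

theorem criticalExponent_mono (h : Γ ≤ Δ) : criticalExponent Γ ≤ criticalExponent Δ := by
  rw [criticalExponent_eq, criticalExponent_eq]
  exact csInf_le_csInf ⟨0, fun s hs => hs.1.le⟩ (exists_poincareSeries_ne_top Δ)
    fun s hs => ⟨hs.1, ne_top_of_le_ne_top hs.2 (FreeGroup.poincareSeries_mono s h)⟩

theorem criticalExponent_le {s : ℝ} (hs : 0 < s) (h : FreeGroup.poincareSeries s Γ ≠ ∞) :
    criticalExponent Γ ≤ s := by
  rw [criticalExponent_eq]
  exact csInf_le ⟨0, fun s hs => hs.1.le⟩ ⟨hs, h⟩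

theorem exists_lt_poincareSeries_ne_top {r : ℝ} (h : criticalExponent Γ < r) :
    ∃ s, 0 < s ∧ s < r ∧ FreeGroup.poincareSeries s Γ ≠ ∞ := by
  rw [criticalExponent_eq] at h
  obtain ⟨s, ⟨hs, hs'⟩, hsr⟩ := exists_lt_of_csInf_lt (exists_poincareSeries_ne_top Γ) h
  exact ⟨s, hs, hsr, hs'⟩

end

/-! ### Increasing unions -/

theorem Subgroup.eventually_mem_of_mem_iSup {G : Type*} [Group G] {H : ℕ → Subgroup G}
    (hH : Monotone H) (F : Finset G) :
    ∀ᶠ n in Filter.atTop, ∀ x ∈ F, x ∈ ⨆ n, H n → x ∈ H n := by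
  rw [Filter.eventually_all_finset]
  intro x _
  by_cases hx : x ∈ ⨆ n, H n
  · obtain ⟨k, hk⟩ := (Subgroup.mem_iSup_of_directed hH.directed_le).1 hx
    filter_upwards [Filter.eventually_ge_atTop k] with n hn _ using hH hn hk
  · exact Filter.Eventually.of_forall fun n h => (hx h).elim

theorem FreeGroup.poincareSeries_iSup_le {α : Type*} [DecidableEq α] {s : ℝ} {B : ℝ≥0∞}
    {H : ℕ → Subgroup (FreeGroup α)} (hH : Monotone H) (hB : ∀ n, poincareSeries s (H n) ≤ B) :
    poincareSeries s (⨆ n, H n) ≤ B := by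
  have hsub : ∀ Γ : Subgroup (FreeGroup α), poincareSeries s Γ =
      ∑' x, (Γ : Set (FreeGroup α)).indicator (poincareTerm s) x := fun Γ =>
    tsum_subtype (Γ : Set (FreeGroup α)) (poincareTerm s)
  rw [hsub, ENNReal.tsum_eq_iSup_sum]
  refine iSup_le fun F => ?_
  obtain ⟨n, hn⟩ := (Subgroup.eventually_mem_of_mem_iSup hH F).exists
  refine le_trans (Finset.sum_le_sum fun x hx => ?_)
    ((ENNReal.sum_le_tsum F).trans ((hsub (H n)).symm.le.trans (hB n)))
  by_cases h : x ∈ ⨆ n, H n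
  · rw [Set.indicator_of_mem h, Set.indicator_of_mem (hn x hx h)]
  · rw [Set.indicator_of_notMem h]; exact zero_le

/-! ### Existence of boomerang subgroups -/

theorem theorem1p2 (d : ℕ) (Γ : Subgroup (FreeGroup (Fin d))) (hΓ : Γ.FG)
    (O : Set (Subgroup (FreeGroup (Fin d)))) (hO : O ∈ 𝓝 Γ) (ε : ℝ) (hε : 0 < ε) :
    ∃ Δ : Subgroup (FreeGroup (Fin d)),
      IsBoomerang Δ ∧ Δ ∈ O ∧
      criticalExponent Γ ≤ criticalExponent Δ ∧
      criticalExponent Δ ≤ criticalExponent Γ + ε ∧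
      ∃ (g : ℕ → FreeGroup (Fin d)) (m : ℕ → ℕ) (H : ℕ → Subgroup (FreeGroup (Fin d))),
        Function.Surjective g ∧ H 0 = Γ ∧ Monotone H ∧
        (∀ n, IsFreeProductStep (g n) (m n) (H n) (H (n + 1))) ∧
        (Δ : Set (FreeGroup (Fin d))) = ⋃ n, (H n : Set (FreeGroup (Fin d))) := by
  classical
  obtain ⟨S, hSΓ, hSO⟩ := Subgroup.exists_finset_of_mem_nhds hO
  obtain ⟨s, hs, hsε, hsΓ⟩ := exists_lt_poincareSeries_ne_top (lt_add_of_pos_right _ hε)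
  obtain ⟨B, hΓB, hB⟩ := ENNReal.lt_iff_exists_nnreal_btwn.1 (lt_top_iff_ne_top.2 hsΓ)
  obtain ⟨f, hf⟩ := exists_surjective_nat (FreeGroup (Fin d))
  -- An enumeration that takes each value infinitely often.
  let e : ℕ → FreeGroup (Fin d) := fun n => f n.unpair.1
  have he : ∀ g N, ∃ n, N ≤ n ∧ e n = g := fun g N => by
    obtain ⟨a, rfl⟩ := hf g
    exact ⟨Nat.pair a N, Nat.right_le_pair a N, by simp [e]⟩
  have hesurj : Function.Surjective e := fun g => (he g 0).imp fun _ h => h.2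
  choose! next mnext hnext using fun (n : ℕ)
    (p : Subgroup (FreeGroup (Fin d)) × Finset (FreeGroup (Fin d)))
    (hp : FreeGroup.IsStage s B p) =>
      hp.exists_succ hs (e n) ((Finset.range (n + 1)).image e) n
  -- The stages: subgroups together with the finite sets excluded so far.
  let p : ℕ → Subgroup (FreeGroup (Fin d)) × Finset (FreeGroup (Fin d)) :=
    fun n => Nat.rec (Γ, S) next n
  have hp : ∀ n, FreeGroup.IsStage s B (p n) := fun n => by
    induction n with
    | zero => exact ⟨hΓ, hSΓ, hΓB⟩
    | succ n ih => exact (hnext n (p n) ih).1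
  have hstep := fun n => (hnext n (p n) (hp n)).2
  have hH : Monotone fun n => (p n).1 := monotone_nat_of_le_succ fun n => (hstep n).1
  have hSmono : Monotone fun n => (p n).2 := monotone_nat_of_le_succ fun n => (hstep n).2.1
  have hmem : ∀ x, x ∈ ⨆ n, (p n).1 ↔ ∃ n, x ∈ (p n).1 := fun x =>
    Subgroup.mem_iSup_of_directed hH.directed_le
  have hexcl : ∀ n, ∀ x ∈ (p n).2, x ∉ ⨆ n, (p n).1 := fun n x hx hx' => by
    obtain ⟨k, hk⟩ := (hmem x).1 hx'
    exact (hp (max n k)).notMem x (hSmono (le_max_left n k) hx) (hH (le_max_right n k) hk)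
  have hΓle : Γ ≤ ⨆ n, (p n).1 := le_iSup (fun n => (p n).1) 0
  refine ⟨⨆ n, (p n).1, isBoomerang_of_forall hesurj fun g hg N => ?_, hSO _ hΓle (hexcl 0),
    criticalExponent_mono hΓle, ?_, e, fun n => mnext n (p n), fun n => (p n).1, hesurj, rfl, hH,
    fun n => (hstep n).2.2.1, Set.ext fun x => by simpa using hmem x⟩
  · -- From stage `N'` on, membership of `e 0, …, e N` in the union is decided.
    obtain ⟨N', hN'⟩ := Filter.eventually_atTop.1
      (Subgroup.eventually_mem_of_mem_iSup hH ((Finset.range (N + 1)).image e))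
    obtain ⟨n, hn, rfl⟩ := he g (max N N')
    obtain ⟨hmn, hconj, hout⟩ := (hstep n).2.2.2.2 fun k hk h => hg k hk ((hmem _).2 ⟨n, h⟩)
    refine ⟨mnext n (p n), by omega, fun i hi => ?_⟩
    by_cases hin : e i ∈ (p n).1
    · refine iff_of_true ((hmem _).2 ⟨n + 1, hconj ?_⟩) ((hmem _).2 ⟨n, hin⟩)
      exact Subgroup.smul_mem_pointwise_smul (e i) (MulAut.conj (e n ^ mnext n (p n))) _ hin
    · refine iff_of_false (hexcl (n + 1) _ (hout (e i) ?_ hin)) fun h =>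
        hin (hN' n (by omega) (e i) ?_ h) <;>
      exact Finset.mem_image_of_mem _ (Finset.mem_range.2 (by omega))
  · refine (criticalExponent_le hs (ne_top_of_le_ne_top hB.ne ?_)).trans hsε.le
    exact FreeGroup.poincareSeries_iSup_le hH fun n => (hp n).poincareSeries_lt.le
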